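/- **Setting.** A base language $\mathcal L$ is a nonempty set of formulas with connectives $\neg,\land,\lor,\Rightarrow$ and a consequence relation $\vdash_{\mathcal L}$ satisfying the axioms of classical propositional logic. Let $W$ be a set of worlds and let $\pi$ map each $w\in W$ to a truth assignment to the formulas of $\mathcal L$ that is consistent with $\vdash_{\mathcal L}$ (it obeys the truth tables of the connectives, and the set of formulas it makes true is closed under $\vdash_{\mathcal L}$). Put $[\![\varphi]\!]=\{w:\pi(w)(\varphi)=\text{true}\}$; the *definable sets* form the algebra $\mathcal F=\{[\![\varphi]\!]:\varphi\in\mathcal L\}$. A *plausibility structure* $(W,\mathrm{Pl},\pi)$ for $\mathcal L$ consists of $W$, $\pi$ as above and a map $\mathrm{Pl}$ from $\mathcal F$ to a partially ordered set with least element $\bot$ and greatest element $\top$ such that $\mathrm{Pl}(\emptyset)=\bot$, $\mathrm{Pl}(W)=\top$, and $A\subseteq B$ implies $\mathrm{Pl}(A)\le\mathrm{Pl}(B)$. It is *qualitative* if - for pairwise disjoint $A,B,C\in\mathcal F$, $\mathrm{Pl}(A\cup B)>\mathrm{Pl}(C)$ and $\mathrm{Pl}(A\cup C)>\mathrm{Pl}(B)$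 imply $\mathrm{Pl}(A)>\mathrm{Pl}(B\cup C)$; and - for $A,B\in\mathcal F$, $\mathrm{Pl}(A)=\mathrm{Pl}(B)=\bot$ implies $\mathrm{Pl}(A\cup B)=\bot$. It is *normal* if $\mathrm{Pl}(W)>\bot$. It satisfies the default $\varphi\to\psi$ if $\mathrm{Pl}([\![\varphi]\!])=\bot$ or $\mathrm{Pl}([\![\varphi\land\psi]\!])>\mathrm{Pl}([\![\varphi\land\neg\psi]\!])$. Two plausibility structures $(W,\mathrm{Pl},\pi)$ and $(W,\mathrm{Pl}',\pi)$ are *default-equivalent* if for all disjoint $A,B\in\mathcal F$: $\mathrm{Pl}(A)<\mathrm{Pl}(B)$ if and only if $\mathrm{Pl}'(A)<\mathrm{Pl}'(B)$. A *parameterized probability distribution* (PPD) is a sequence $(\Pr_i)_{i\ge 0}$ of finitely additive probability measures on $\mathcal F$. Conditional probabilities $\Pr_i(B\mid A)$ are taken to be $1$ when $\Pr_i(A)=0$. The PPD structure $(W,(\Pr_i),\pi)$ satisfies $\varphi\to\psi$ if $\lim_{i\to\infty}\Pr_i([\![\psi]\!]\mid[\![\varphi]\!])=1$. A plausibility structure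 $(W,\mathrm{Pl}',\pi)$ *arises from* the PPD if for all $A,B\in\mathcal F$: $\mathrm{Pl}'(A)\le\mathrm{Pl}'(B)$ if and only if $\lim_{i\to\infty}\Pr_i(B\mid A\cup B)=1$. **Theorem.** Let $\mathcal L$ be countable and let $(W,\mathrm{Pl},\pi)$ be a normal qualitative plausibility structure for $\mathcal L$. Then there are a PPD $(\Pr_i)$ on $\mathcal F$ and a plausibility structure $(W,\mathrm{Pl}',\pi)$ arising from it that is default-equivalent to $(W,\mathrm{Pl},\pi)$. Moreover $(W,\mathrm{Pl},\pi)$, $(W,\mathrm{Pl}',\pi)$ and the PPD structure $(W,(\Pr_i),\pi)$ satisfy the same defaults $\varphi\to\psi$ with $\varphi,\psi\in\mathcal L$. -/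

import Mathlib

open Filter Topology

universe u v w

namespace Plausibility

/-- A base language: a set of formulas with the usual propositional connectives, together with a
(reflexive, monotone, transitive) consequence relation satisfying the axioms of classical
propositional logic. Neither compactness nor any further structure of the formulas is required. -/
structure BaseLanguage where
  Formula : Type u
  nonempty : Nonempty Formula
  neg : Formula → Formula
  and : Formula → Formula → Formula
  or : Formula → Formula → Formula
  imp : Formula → Formula → Formula
  /-- `Entails Γ φ` says that `φ` is a consequence of the set of formulas `Γ`. -/
  Entails : Set Formula → Formula → Prop
  entails_refl : ∀ (Γ : Set Formula) (φ : Formula), φ ∈ Γ → Entails Γ φ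
  entails_mono : ∀ (Γ Δ : Set Formula) (φ : Formula), Γ ⊆ Δ → Entails Γ φ → Entails Δ φ
  entails_trans : ∀ (Γ Δ : Set Formula) (φ : Formula),
    (∀ ψ ∈ Δ, Entails Γ ψ) → Entails Δ φ → Entails Γ φ
  modus_ponens : ∀ φ ψ : Formula, Entails {φ, imp φ ψ} ψ
  ax_k : ∀ φ ψ : Formula, Entails ∅ (imp φ (imp ψ φ))
  ax_s : ∀ φ ψ χ : Formula,
    Entails ∅ (imp (imp φ (imp ψ χ)) (imp (imp φ ψ) (imp φ χ)))
  ax_contrapositive : ∀ φ ψ : Formula,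
    Entails ∅ (imp (imp (neg φ) (neg ψ)) (imp ψ φ))
  ax_and_left : ∀ φ ψ : Formula, Entails ∅ (imp (and φ ψ) φ)
  ax_and_right : ∀ φ ψ : Formula, Entails ∅ (imp (and φ ψ) ψ)
  ax_and_intro : ∀ φ ψ : Formula, Entails ∅ (imp φ (imp ψ (and φ ψ)))
  ax_or_left : ∀ φ ψ : Formula, Entails ∅ (imp φ (or φ ψ))
  ax_or_right : ∀ φ ψ : Formula, Entails ∅ (imp ψ (or φ ψ))
  ax_or_elim : ∀ φ ψ χ : Formula,
    Entails ∅ (imp (imp φ χ) (imp (imp ψ χ) (imp (or φ ψ) χ)))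

/-- A truth assignment to the formulas of `L` that is consistent with the consequence relation
of `L`: it obeys the truth tables of the connectives, and it makes every consequence of formulas
that it makes true, true. -/
structure BaseLanguage.IsTruthAssignment (L : BaseLanguage.{u}) (t : L.Formula → Prop) :
    Prop where
  neg_iff : ∀ φ, t (L.neg φ) ↔ ¬ t φ
  and_iff : ∀ φ ψ, t (L.and φ ψ) ↔ (t φ ∧ t ψ)
  or_iff : ∀ φ ψ, t (L.or φ ψ) ↔ (t φ ∨ t ψ)
  imp_iff : ∀ φ ψ, t (L.imp φ ψ) ↔ (t φ → t ψ)
  sound : ∀ (Γ : Set L.Formula) (φ : L.Formula), L.Entails Γ φ → (∀ γ ∈ Γ, t γ) → t φ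

/-- The component `π` of a structure on the set `W` of possible worlds: it maps each world to a
truth assignment to the formulas of `L` that is consistent with the consequence relation. -/
structure Interpretation (L : BaseLanguage.{u}) (W : Type v) where
  truth : W → L.Formula → Prop
  isTruthAssignment : ∀ x, L.IsTruthAssignment (truth x)

namespace Interpretation

variable {L : BaseLanguage.{u}} {W : Type v} (π : Interpretation L W)

/-- `⟦φ⟧`, the set of worlds at which `φ` is true. -/
def ext (φ : L.Formula) : Set W := {x | π.truth x φ}

/-- The algebra `F = {⟦φ⟧ : φ ∈ L}` of definable sets of worlds. -/
def events : BooleanSubalgebra (Set W) where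
  carrier := Set.range π.ext
  supClosed' := by
    rintro _ ⟨φ, rfl⟩ _ ⟨ψ, rfl⟩
    exact ⟨L.or φ ψ, Set.ext fun x => (π.isTruthAssignment x).or_iff φ ψ⟩
  infClosed' := by
    rintro _ ⟨φ, rfl⟩ _ ⟨ψ, rfl⟩
    exact ⟨L.and φ ψ, Set.ext fun x => (π.isTruthAssignment x).and_iff φ ψ⟩
  compl_mem' := by
    rintro _ ⟨φ, rfl⟩
    exact ⟨L.neg φ, Set.ext fun x => (π.isTruthAssignment x).neg_iff φ⟩
  bot_mem' := by
    obtain ⟨φ⟩ := L.nonempty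
    refine ⟨L.and φ (L.neg φ), Set.ext fun x => ?_⟩
    have h1 := (π.isTruthAssignment x).and_iff φ (L.neg φ)
    have h2 := (π.isTruthAssignment x).neg_iff φ
    simp only [ext, Set.mem_ofPred_eq, h1, h2, Set.bot_eq_empty, Set.mem_empty_iff_false]
    tauto

/-- `⟦φ⟧` as an element of the algebra of definable sets. -/
def event (φ : L.Formula) : π.events := ⟨π.ext φ, φ, rfl⟩

end Interpretation

/-- A plausibility measure on an algebra `F` of subsets of `W`: a monotone map from `F` to a
pointed partially ordered set `D`, mapping the empty set to the least element of `D` and `W` to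
the greatest element of `D`. -/
structure PlausibilityMeasure {W : Type v} (F : BooleanSubalgebra (Set W)) where
  D : Type w
  [instPartialOrder : PartialOrder D]
  [instBoundedOrder : BoundedOrder D]
  Pl : F → D
  map_bot : Pl ⊥ = ⊥
  map_top : Pl ⊤ = ⊤
  mono : ∀ A B : F, (A : Set W) ⊆ B → Pl A ≤ Pl B

attribute [instance] PlausibilityMeasure.instPartialOrder PlausibilityMeasure.instBoundedOrder

namespace PlausibilityMeasure

variable {W : Type v} {F : BooleanSubalgebra (Set W)}

/-- Qualitative plausibility measures: the conditions A2 and A3, in addition to monotonicity. -/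
structure IsQualitative (P : PlausibilityMeasure.{v, w} F) : Prop where
  a2 : ∀ A B C : F, Disjoint (A : Set W) B → Disjoint (A : Set W) C → Disjoint (B : Set W) C →
    P.Pl C < P.Pl (A ⊔ B) → P.Pl B < P.Pl (A ⊔ C) → P.Pl (B ⊔ C) < P.Pl A
  a3 : ∀ A B : F, P.Pl A = ⊥ → P.Pl B = ⊥ → P.Pl (A ⊔ B) = ⊥

/-- Normality: the plausibility of the set of all worlds is above the least element. -/
def IsNormal (P : PlausibilityMeasure.{v, w} F) : Prop := ⊥ < P.Pl ⊤

/-- Default-equivalence: the same strict comparisons between disjoint sets. -/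
def DefaultEquivalent (P P' : PlausibilityMeasure.{v, w} F) : Prop :=
  ∀ A B : F, Disjoint (A : Set W) B → (P.Pl A < P.Pl B ↔ P'.Pl A < P'.Pl B)

/-- The plausibility structure `(W, Pl, π)` satisfies the default `φ → ψ`. -/
def SatDefault {L : BaseLanguage.{u}} {π : Interpretation L W}
    (P : PlausibilityMeasure.{v, w} π.events) (φ ψ : L.Formula) : Prop :=
  P.Pl (π.event φ) = ⊥ ∨
    P.Pl (π.event (L.and φ (L.neg ψ))) < P.Pl (π.event (L.and φ ψ))

end PlausibilityMeasure

/-- A (finitely additive) probability measure on an algebra `F` of subsets of `W`. -/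
structure ProbMeasure {W : Type v} (F : BooleanSubalgebra (Set W)) where
  prob : F → ℝ
  nonneg : ∀ A, 0 ≤ prob A
  le_one : ∀ A, prob A ≤ 1
  prob_bot : prob ⊥ = 0
  prob_top : prob ⊤ = 1
  additive : ∀ A B : F, Disjoint (A : Set W) B → prob (A ⊔ B) = prob A + prob B

open Classical in
/-- The conditional probability `Pr(B | A)`, taken to be `1` if `Pr(A) = 0`. -/
noncomputable def ProbMeasure.cond {W : Type v} {F : BooleanSubalgebra (Set W)}
    (μ : ProbMeasure F) (B A : F) : ℝ :=
  if μ.prob A = 0 then 1 else μ.prob (B ⊓ A) / μ.prob A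

/-- A parameterized probability distribution (PPD): a sequence of probability measures. -/
abbrev PPD {W : Type v} (F : BooleanSubalgebra (Set W)) : Type v := ℕ → ProbMeasure F

/-- The PPD structure `(W, (Pr_i), π)` satisfies the default `φ → ψ`. -/
def PPD.SatDefault {L : BaseLanguage.{u}} {W : Type v} {π : Interpretation L W}
    (p : PPD π.events) (φ ψ : L.Formula) : Prop :=
  Tendsto (fun i => (p i).cond (π.event ψ) (π.event φ)) atTop (𝓝 1)

/-- The plausibility measure `P` is one that arises from the PPD `p`: `Pl(A) ≤ Pl(B)` if and only
if `Pr_i(B | A ∪ B)` tends to `1`. -/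
def PlausibilityMeasure.ArisesFrom {W : Type v} {F : BooleanSubalgebra (Set W)}
    (P : PlausibilityMeasure.{v, w} F) (p : PPD F) : Prop :=
  ∀ A B : F, P.Pl A ≤ P.Pl B ↔ Tendsto (fun i => (p i).cond B (A ⊔ B)) atTop (𝓝 1)

end Plausibility

/-! The core is finite. Given finitely many strict comparisons `C < D` of disjoint events, a null
event `N`, some `ε > 0` and one failing comparison `¬ A < B` of disjoint events, some content kills
`N`, makes each `C` at most `ε` times a positive `D`, and still has `m B ≤ m A`. It is a finite sum
of point masses. Condition A2 makes the union of `N` and all the `C` implausible relative to the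
union `U` of all the events; if the rest of `U` lay inside `B`, monotonicity would give `A < B`. So
some point avoids `N`, `B` and every `C`, and lies in `A` or in some `D`. A dominant mass there
settles every pair whose `D` contains it, and does not affect the other pairs; recursion handles
those (`exists_point`, `extend`, `exists_respects_of_not_lt`).

Countability then allows a diagonal construction (`exists_ppd`): true comparisons are imposed from
some stage on with `ε → 0`, and each failing one is refuted infinitely often. Hence the limit order
has exactly the original strict comparisons of disjoint events. -/

namespace Plausibility

/-! ### Contents and the addition of a dominant point mass. -/

section Contents

variable {W : Type v} {F : BooleanSubalgebra (Set W)}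

/-- A finitely additive nonnegative real-valued set function on an algebra of sets. -/
structure IsContent (m : F → ℝ) : Prop where
  nonneg : ∀ A, 0 ≤ m A
  map_bot : m ⊥ = 0
  additive : ∀ A B : F, Disjoint (A : Set W) B → m (A ⊔ B) = m A + m B

theorem disjoint_coe_iff {A B : F} : Disjoint (A : Set W) B ↔ Disjoint A B := by
  rw [disjoint_iff, disjoint_iff, ← Subtype.coe_inj]
  rfl

theorem IsContent.mono {m : F → ℝ} (hm : IsContent m) {A B : F} (h : A ≤ B) : m A ≤ m B := by
  have h1 := hm.additive A (B \ A) (disjoint_coe_iff.2 disjoint_sdiff_self_right)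
  rw [sup_sdiff_cancel_right h] at h1
  linarith [hm.nonneg (B \ A)]

theorem ProbMeasure.isContent (μ : ProbMeasure F) : IsContent μ.prob :=
  ⟨μ.nonneg, μ.prob_bot, μ.additive⟩

theorem isContent_zero : IsContent (fun _ : F => (0 : ℝ)) :=
  ⟨fun _ => le_rfl, rfl, fun _ _ _ => by simp⟩

open Classical in
/-- Adding a point mass to a content. -/
theorem IsContent.add_point {m : F → ℝ} (hm : IsContent m) (x : W) {K : ℝ} (hK : 0 ≤ K) :
    IsContent (fun A : F => m A + if x ∈ (A : Set W) then K else 0) where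
  nonneg A := by
    have := hm.nonneg A
    split_ifs <;> linarith
  map_bot := by simp [hm.map_bot]
  additive A B h := by
    have h1 : x ∈ ((A ⊔ B : F) : Set W) ↔ x ∈ (A : Set W) ∨ x ∈ (B : Set W) := Iff.rfl
    have h2 : ¬ (x ∈ (A : Set W) ∧ x ∈ (B : Set W)) := fun h' =>
      Set.disjoint_left.1 h h'.1 h'.2
    simp only [hm.additive A B h, h1]
    by_cases hA : x ∈ (A : Set W) <;> by_cases hB : x ∈ (B : Set W) <;> simp_all <;> ring

/-- The content `m` vanishes on `N` and makes `C` smaller than `ε` times `D`, and `D` positive,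
for all pairs `(C, D)` in `J`. -/
structure IsContent.Respects (m : F → ℝ) (N : F) (ε : ℝ) (J : Finset (F × F)) : Prop where
  isContent : IsContent m
  null : m N = 0
  small : ∀ c ∈ J, m c.1 ≤ ε * m c.2
  pos : ∀ c ∈ J, 0 < m c.2

-- A pair with `x` in its larger side is won by the new mass; the remaining pairs contain `x` on
-- neither side, so their values do not change.
open Classical in
theorem IsContent.Respects.extend {m : F → ℝ} {N : F} {ε : ℝ} (hε : 0 < ε) {J : Finset (F × F)}
    {x : W} (hm : IsContent.Respects m N ε (J.filter fun c => x ∉ (c.2 : Set W)))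
    (hxN : x ∉ (N : Set W)) (hxJ : ∀ c ∈ J, x ∉ (c.1 : Set W)) :
    ∃ m' : F → ℝ, IsContent.Respects m' N ε J ∧ (∀ E : F, x ∈ (E : Set W) → m ⊤ ≤ m' E) ∧
      ∀ E : F, x ∉ (E : Set W) → m' E = m E := by
  have htop := hm.isContent.nonneg ⊤
  have hdiv : 0 ≤ m ⊤ / ε := by positivity
  have hmul : ε * (m ⊤ / ε) = m ⊤ := by field_simp
  -- In the added mass, `m ⊤ / ε` gives smallness, `1` gives positivity, and `m ⊤` dominates the old
  -- total.
  refine ⟨_, ⟨hm.isContent.add_point x (K := m ⊤ + m ⊤ / ε + 1) (by positivity), ?_, ?_, ?_⟩,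
    ?_, ?_⟩
  · simp [hxN, hm.null]
  · intro c hc
    by_cases h : x ∈ (c.2 : Set W)
    · simp only [hxJ c hc, h, if_true, if_false, add_zero]
      have h1 := hm.isContent.mono (le_top : c.1 ≤ ⊤)
      have h2 : 0 ≤ ε * (m c.2 + m ⊤ + 1) := by
        have := hm.isContent.nonneg c.2
        positivity
      nlinarith
    · simpa [hxJ c hc, h] using hm.small c (Finset.mem_filter.2 ⟨hc, h⟩)
  · intro c hc
    by_cases h : x ∈ (c.2 : Set W)
    · simp only [h, if_true]
      linarith [hm.isContent.nonneg c.2]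
    · simpa [h] using hm.pos c (Finset.mem_filter.2 ⟨hc, h⟩)
  · intro E hE
    simp only [hE, if_true]
    linarith [hm.isContent.nonneg E]
  · intro E hE
    simp [hE]

end Contents

/-! ### From qualitative plausibility to a sequence of probability measures. -/

namespace PlausibilityMeasure

section Qualitative

variable {W : Type v} {F : BooleanSubalgebra (Set W)} {P : PlausibilityMeasure.{v, w} F}

theorem monotone_pl (P : PlausibilityMeasure.{v, w} F) : Monotone P.Pl := fun A B h => P.mono A B h

/-- Sets implausible relative to `U` are closed under union: this is A2 for the disjoint sets `U \
(X ⊔ Y)`, `X` and `Y \ X`. -/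
theorem IsQualitative.sup_lt_sdiff (hq : P.IsQualitative) {U X Y : F}
    (hX : P.Pl X < P.Pl (U \ X)) (hY : P.Pl Y < P.Pl (U \ Y)) :
    P.Pl (X ⊔ Y) < P.Pl (U \ (X ⊔ Y)) := by
  have h1 : Disjoint (U \ (X ⊔ Y)) X := disjoint_sdiff_self_left.mono_right le_sup_left
  have h2 : Disjoint (U \ (X ⊔ Y)) (Y \ X) :=
    disjoint_sdiff_self_left.mono_right (sdiff_le.trans le_sup_right)
  have h := hq.a2 (U \ (X ⊔ Y)) X (Y \ X) (disjoint_coe_iff.2 h1) (disjoint_coe_iff.2 h2)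
    (disjoint_coe_iff.2 disjoint_sdiff_self_right)
    ((P.monotone_pl sdiff_le).trans_lt (hY.trans_le (P.monotone_pl ?_)))
    (hX.trans_le (P.monotone_pl ?_))
  · rwa [sup_sdiff_self_right] at h
  · rw [sdiff_le_iff, sup_comm _ X, ← sup_assoc, sup_comm Y X]
    exact le_sup_sdiff
  · rw [sdiff_le_iff, sup_comm _ (Y \ X), ← sup_assoc, sup_sdiff_self_right]
    exact le_sup_sdiff

theorem IsQualitative.sup_null (hq : P.IsQualitative) {s : Finset F}
    (hs : ∀ A ∈ s, P.Pl A = ⊥) : P.Pl (s.sup id) = ⊥ :=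
  Finset.sup_induction (p := fun E => P.Pl E = ⊥) P.map_bot (fun A hA B hB => hq.a3 A B hA hB) hs

/-- There is a world at which a ranking of worlds that respects the comparisons in `J`, but not
`A < B`, can put its largest mass. -/
theorem IsQualitative.exists_point (hq : P.IsQualitative) {N : F} (hN : P.Pl N = ⊥)
    {J : Finset (F × F)}
    (hJ : ∀ c ∈ J, Disjoint c.1 c.2 ∧ P.Pl c.1 < P.Pl c.2) (hne : J.Nonempty)
    {A B : F} (hAB : Disjoint A B) (hlt : ¬ P.Pl A < P.Pl B) :
    ∃ x : W, x ∉ (N : Set W) ∧ x ∉ (B : Set W) ∧ (∀ c ∈ J, x ∉ (c.1 : Set W)) ∧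
      (x ∈ (A : Set W) ∨ ∃ c ∈ J, x ∈ (c.2 : Set W)) := by
  set U : F := J.sup (fun c => c.1 ⊔ c.2) ⊔ A ⊔ B with hU
  have hcU : ∀ c ∈ J, c.1 ⊔ c.2 ≤ U := fun c hc =>
    (Finset.le_sup (f := fun c : F × F => c.1 ⊔ c.2) hc).trans (le_sup_left.trans le_sup_left)
  have hNU : P.Pl N < P.Pl (U \ N) := by
    obtain ⟨c, hc⟩ := hne
    rw [hN, bot_lt_iff_ne_bot]
    intro h
    have h1 := hq.a3 _ _ h hN
    have h2 : P.Pl c.2 ≤ P.Pl (U \ N ⊔ N) :=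
      P.monotone_pl ((le_sup_right.trans (hcU c hc)).trans le_sdiff_sup)
    rw [h1] at h2
    exact not_lt_bot ((hJ c hc).2.trans_le h2)
  have hV : P.Pl (N ⊔ J.sup Prod.fst) < P.Pl (U \ (N ⊔ J.sup Prod.fst)) := by
    have key : ∀ J' ⊆ J, P.Pl (N ⊔ J'.sup Prod.fst) < P.Pl (U \ (N ⊔ J'.sup Prod.fst)) := by
      classical
      intro J'
      induction J' using Finset.induction_on with
      | empty => intro _; simpa using hNU
      | insert c s _ ih =>
        intro hs
        have hc := hs (Finset.mem_insert_self _ _)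
        have h1 := ih ((Finset.subset_insert _ _).trans hs)
        have h2 : P.Pl c.1 < P.Pl (U \ c.1) :=
          (hJ c hc).2.trans_le (P.monotone_pl
            (le_sdiff.2 ⟨le_sup_right.trans (hcU c hc), (hJ c hc).1.symm⟩))
        have h3 := hq.sup_lt_sdiff h2 h1
        rwa [Finset.sup_insert, sup_left_comm]
    exact key J subset_rfl
  -- Otherwise `A`, being disjoint from `B`, lies in the implausible part, and monotonicity yields
  -- `A < B`.
  have hnot : ¬ U \ (N ⊔ J.sup Prod.fst) ≤ B := by
    intro h
    have hA : A ≤ N ⊔ J.sup Prod.fst := by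
      have h1 : A ≤ U := le_sup_right.trans le_sup_left
      rw [sdiff_le_iff] at h
      exact hAB.left_le_of_le_sup_right (h1.trans h)
    exact hlt ((P.monotone_pl hA).trans_lt (hV.trans_le (P.monotone_pl h)))
  have hnot' : ¬ ((U \ (N ⊔ J.sup Prod.fst) : F) : Set W) ⊆ B := hnot
  obtain ⟨x, ⟨hxU, hxV⟩, hxB⟩ := Set.not_subset.1 hnot'
  have hsub : ∀ {E G : F}, E ≤ G → x ∈ (E : Set W) → x ∈ (G : Set W) := fun h hx => h hx
  have hxJ : ∀ c ∈ J, x ∉ (c.1 : Set W) := fun c hc hx =>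
    hxV (hsub ((Finset.le_sup (f := Prod.fst) hc).trans le_sup_right) hx)
  refine ⟨x, fun hx => hxV (hsub le_sup_left hx), hxB, hxJ, ?_⟩
  by_contra! hcon
  have hsup : ∀ J' ⊆ J, x ∉ ((J'.sup fun c => c.1 ⊔ c.2 : F) : Set W) := by
    classical
    intro J'
    induction J' using Finset.induction_on with
    | empty => exact fun _ h => h
    | insert c s _ ih =>
      intro hs hx
      rw [Finset.sup_insert] at hx
      have hc := hs (Finset.mem_insert_self _ _)
      rcases hx with (hx | hx) | hx
      · exact hxJ c hc hx
      · exact hcon.2 c hc hx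
      · exact ih ((Finset.subset_insert _ _).trans hs) hx
  rcases hxU with (hx | hx) | hx
  · exact hsup J subset_rfl hx
  · exact hcon.1 hx
  · exact hxB hx

theorem IsQualitative.exists_respects (hq : P.IsQualitative) {N : F} (hN : P.Pl N = ⊥) {ε : ℝ}
    (hε : 0 < ε) (J : Finset (F × F)) :
    (∀ c ∈ J, Disjoint c.1 c.2 ∧ P.Pl c.1 < P.Pl c.2) →
      ∃ m : F → ℝ, IsContent.Respects m N ε J := by
  classical
  induction J using Finset.strongInduction with
  | H J ih =>
    intro hJ
    rcases J.eq_empty_or_nonempty with rfl | hne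
    · exact ⟨_, isContent_zero, rfl, by simp, by simp⟩
    -- The trivial failing comparison `⊥ < ⊥` forces the point into some larger side, so the
    -- recursion loses a pair.
    · obtain ⟨x, hxN, -, hxJ, hx⟩ := hq.exists_point hN hJ hne (disjoint_bot_left (a := ⊥))
        (lt_irrefl _)
      obtain ⟨c, hc, hxc⟩ := hx.resolve_left (fun h => h)
      obtain ⟨m, hm⟩ := ih (J.filter fun c => x ∉ (c.2 : Set W))
        (Finset.filter_ssubset.2 ⟨c, hc, fun h => h hxc⟩)
        (fun d hd => hJ d (Finset.mem_filter.1 hd).1)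
      obtain ⟨m', hm', -⟩ := hm.extend hε hxN hxJ
      exact ⟨m', hm'⟩

theorem IsQualitative.exists_respects_of_not_lt (hq : P.IsQualitative) {N : F}
    (hN : P.Pl N = ⊥) {ε : ℝ} (hε : 0 < ε) {A B : F} (hAB : Disjoint A B)
    (hlt : ¬ P.Pl A < P.Pl B) (J : Finset (F × F)) :
    (∀ c ∈ J, Disjoint c.1 c.2 ∧ P.Pl c.1 < P.Pl c.2) →
      ∃ m : F → ℝ, IsContent.Respects m N ε J ∧ m B ≤ m A := by
  classical
  induction J using Finset.strongInduction with
  | H J ih =>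
    intro hJ
    rcases J.eq_empty_or_nonempty with rfl | hne
    · exact ⟨_, ⟨isContent_zero, rfl, by simp, by simp⟩, le_rfl⟩
    · obtain ⟨x, hxN, hxB, hxJ, hx⟩ := hq.exists_point hN hJ hne hAB hlt
      have hJ' : ∀ d ∈ J.filter (fun c => x ∉ (c.2 : Set W)),
          Disjoint d.1 d.2 ∧ P.Pl d.1 < P.Pl d.2 := fun d hd => hJ d (Finset.mem_filter.1 hd).1
      -- If `x` is in `A`, its mass already outweighs `B`; otherwise it leaves both `A` and `B`
      -- unchanged and the induction hypothesis applies.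
      by_cases hxA : x ∈ (A : Set W)
      · obtain ⟨m, hm⟩ := hq.exists_respects hN hε _ hJ'
        obtain ⟨m', hm', h1, h2⟩ := hm.extend hε hxN hxJ
        exact ⟨m', hm', (h2 B hxB).le.trans ((hm.isContent.mono le_top).trans (h1 A hxA))⟩
      · obtain ⟨c, hc, hxc⟩ := hx.resolve_left hxA
        obtain ⟨m, hm, hBA⟩ := ih _ (Finset.filter_ssubset.2 ⟨c, hc, fun h => h hxc⟩) hJ'
        obtain ⟨m', hm', -, h2⟩ := hm.extend hε hxN hxJ
        exact ⟨m', hm', by rwa [h2 B hxB, h2 A hxA]⟩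

theorem IsQualitative.exists_probMeasure (hq : P.IsQualitative) (hn : P.IsNormal) {N : F}
    (hN : P.Pl N = ⊥) {ε : ℝ} (hε : 0 < ε) {A B : F} (hAB : Disjoint A B)
    (hlt : ¬ P.Pl A < P.Pl B) (J : Finset (F × F))
    (hJ : ∀ c ∈ J, Disjoint c.1 c.2 ∧ P.Pl c.1 < P.Pl c.2) :
    ∃ μ : ProbMeasure F, IsContent.Respects μ.prob N ε J ∧ μ.prob B ≤ μ.prob A := by
  classical
  -- By normality `⊥ < ⊤` may join the pairs; it makes the total mass positive, so that `m` can be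
  -- normalized.
  obtain ⟨m, hm, hBA⟩ := hq.exists_respects_of_not_lt hN hε hAB hlt (insert (⊥, ⊤) J) (by
    intro c hc
    rcases Finset.mem_insert.1 hc with rfl | hc
    · exact ⟨disjoint_bot_left, P.map_bot.trans_lt hn⟩
    · exact hJ c hc)
  have htop : 0 < m ⊤ := hm.pos (⊥, ⊤) (Finset.mem_insert_self _ _)
  have hc := hm.isContent
  let μ : ProbMeasure F :=
    { prob := fun E => m E / m ⊤
      nonneg := fun E => div_nonneg (hc.nonneg E) htop.le
      le_one := fun E => div_le_one_of_le₀ (hc.mono le_top) htop.le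
      prob_bot := by simp [hc.map_bot]
      prob_top := div_self htop.ne'
      additive := fun E G h => by rw [hc.additive E G h, add_div] }
  refine ⟨μ, ⟨μ.isContent, ?_, fun c hcJ => ?_, fun c hcJ => ?_⟩,
    div_le_div_of_nonneg_right hBA htop.le⟩
  · change m N / m ⊤ = 0
    rw [hm.null, zero_div]
  · change m c.1 / m ⊤ ≤ ε * (m c.2 / m ⊤)
    rw [← mul_div_assoc]
    exact div_le_div_of_nonneg_right (hm.small c (Finset.mem_insert_of_mem hcJ)) htop.le
  · exact div_pos (hm.pos c (Finset.mem_insert_of_mem hcJ)) htop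

theorem IsQualitative.exists_ppd [Countable F] (hq : P.IsQualitative) (hn : P.IsNormal) :
    ∃ p : PPD F,
      (∀ A, P.Pl A = ⊥ → ∀ᶠ i in atTop, (p i).prob A = 0) ∧
      (∀ A B, Disjoint A B → P.Pl A < P.Pl B → ∀ ε > 0, ∀ᶠ i in atTop,
        (p i).prob A ≤ ε * (p i).prob B ∧ 0 < (p i).prob B) ∧
      (∀ A B, Disjoint A B → ¬ P.Pl A < P.Pl B → ∃ᶠ i in atTop,
        (p i).prob B ≤ (p i).prob A) := by
  classical
  obtain ⟨e, he⟩ := exists_surjective_nat (F × F)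
  have hex : ∀ i : ℕ, ∃ μ : ProbMeasure F,
      (∀ j ≤ i, P.Pl (e j).1 = ⊥ → μ.prob (e j).1 = 0) ∧
      (∀ j ≤ i, Disjoint (e j).1 (e j).2 → P.Pl (e j).1 < P.Pl (e j).2 →
        μ.prob (e j).1 ≤ 1 / ((i : ℝ) + 1) * μ.prob (e j).2 ∧ 0 < μ.prob (e j).2) ∧
      (Disjoint (e i.unpair.1).1 (e i.unpair.1).2 →
        ¬ P.Pl (e i.unpair.1).1 < P.Pl (e i.unpair.1).2 →
        μ.prob (e i.unpair.1).2 ≤ μ.prob (e i.unpair.1).1) := by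
    intro i
    let S : Finset F := ((Finset.range (i + 1)).image fun j => (e j).1).filter fun E => P.Pl E = ⊥
    let J : Finset (F × F) := ((Finset.range (i + 1)).image e).filter
      fun c => Disjoint c.1 c.2 ∧ P.Pl c.1 < P.Pl c.2
    have hS : P.Pl (S.sup id) = ⊥ := hq.sup_null fun E hE => (Finset.mem_filter.1 hE).2
    have hJ : ∀ c ∈ J, Disjoint c.1 c.2 ∧ P.Pl c.1 < P.Pl c.2 :=
      fun c hc => (Finset.mem_filter.1 hc).2
    have hε : (0 : ℝ) < 1 / ((i : ℝ) + 1) := by positivity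
    obtain ⟨μ, hμ, hle⟩ : ∃ μ : ProbMeasure F,
        IsContent.Respects μ.prob (S.sup id) (1 / ((i : ℝ) + 1)) J ∧
        (Disjoint (e i.unpair.1).1 (e i.unpair.1).2 →
          ¬ P.Pl (e i.unpair.1).1 < P.Pl (e i.unpair.1).2 →
          μ.prob (e i.unpair.1).2 ≤ μ.prob (e i.unpair.1).1) := by
      by_cases h : Disjoint (e i.unpair.1).1 (e i.unpair.1).2 ∧
          ¬ P.Pl (e i.unpair.1).1 < P.Pl (e i.unpair.1).2
      · obtain ⟨μ, hμ, hle⟩ := hq.exists_probMeasure hn hS hε h.1 h.2 J hJ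
        exact ⟨μ, hμ, fun _ _ => hle⟩
      · obtain ⟨μ, hμ, -⟩ := hq.exists_probMeasure hn hS hε (disjoint_bot_left (a := ⊥))
          (lt_irrefl _) J hJ
        exact ⟨μ, hμ, fun h1 h2 => absurd ⟨h1, h2⟩ h⟩
    refine ⟨μ, fun j hj hnull => ?_, fun j hj hd hl => ?_, hle⟩
    · refine le_antisymm ?_ (μ.nonneg _)
      rw [← hμ.null]
      refine hμ.isContent.mono (Finset.le_sup (f := id) (Finset.mem_filter.2 ⟨?_, hnull⟩))
      exact Finset.mem_image_of_mem (fun j => (e j).1) (Finset.mem_range.2 (by omega))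
    · have hmem : e j ∈ J := Finset.mem_filter.2
        ⟨Finset.mem_image_of_mem e (Finset.mem_range.2 (by omega)), hd, hl⟩
      exact ⟨hμ.small _ hmem, hμ.pos _ hmem⟩
  choose p hp1 hp2 hp3 using hex
  refine ⟨p, fun A hA => ?_, fun A B hAB hlt ε hε => ?_, fun A B hAB hlt => ?_⟩
  · obtain ⟨j, hj⟩ := he (A, ⊥)
    filter_upwards [eventually_ge_atTop j] with i hi
    have := hp1 i j hi
    rw [hj] at this
    exact this hA
  · obtain ⟨j, hj⟩ := he (A, B)
    filter_upwards [eventually_ge_atTop j,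
      tendsto_one_div_add_atTop_nhds_zero_nat.eventually_le_const hε] with i hi hiε
    have := hp2 i j hi
    rw [hj] at this
    obtain ⟨h1, h2⟩ := this hAB hlt
    exact ⟨h1.trans (mul_le_mul_of_nonneg_right hiε h2.le), h2⟩
  · obtain ⟨j, hj⟩ := he (A, B)
    -- Every stage `Nat.pair j a` refutes pair `j`, and these stages are unbounded.
    refine frequently_atTop.2 fun a => ⟨Nat.pair j a, Nat.right_le_pair j a, ?_⟩
    have := hp3 (Nat.pair j a)
    rw [Nat.unpair_pair, hj] at this
    exact this hAB hlt

end Qualitative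

end PlausibilityMeasure

/-! ### The limit preorder of a sequence of probability measures. -/

namespace PPD

variable {W : Type v} {F : BooleanSubalgebra (Set W)}

/-- The likelihood comparison of events determined by a PPD. -/
def LE (p : PPD F) (A B : F) : Prop :=
  Tendsto (fun i => (p i).cond B (A ⊔ B)) atTop (𝓝 1)

/-- A division-free form that also absorbs the convention for conditioning on a null event. -/
theorem le_iff {p : PPD F} {A B : F} :
    p.LE A B ↔ ∀ ε > 0, ∀ᶠ i in atTop, (p i).prob (A \ B) ≤ ε * (p i).prob B := by
  have hadd : ∀ i, (p i).prob (A ⊔ B) = (p i).prob (A \ B) + (p i).prob B := fun i => by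
    rw [← (p i).additive _ _ (disjoint_coe_iff.2 disjoint_sdiff_self_left), sdiff_sup_self]
  have hinf : B ⊓ (A ⊔ B) = B := inf_eq_left.2 le_sup_right
  constructor
  · intro h ε hε
    have h1 : 1 / (1 + ε) < 1 := by
      rw [div_lt_one (by positivity)]
      linarith
    filter_upwards [h.eventually (lt_mem_nhds h1)] with i hi
    have hA := (p i).nonneg (A \ B)
    have hB := (p i).nonneg B
    unfold ProbMeasure.cond at hi
    rw [hinf] at hi
    split_ifs at hi with h0
    · rw [hadd] at h0
      nlinarith
    · have hpos := lt_of_le_of_ne ((p i).nonneg (A ⊔ B)) (Ne.symm h0)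
      rw [div_lt_div_iff₀ (by positivity) hpos, hadd] at hi
      linarith
  · intro h
    rw [LE, Metric.tendsto_nhds]
    intro ε hε
    filter_upwards [h (ε / 2) (by positivity)] with i hi
    have hA := (p i).nonneg (A \ B)
    have hB := (p i).nonneg B
    unfold ProbMeasure.cond
    rw [hinf]
    split_ifs with h0
    · simpa using hε
    · have hpos := lt_of_le_of_ne ((p i).nonneg (A ⊔ B)) (Ne.symm h0)
      rw [Real.dist_eq, abs_sub_lt_iff]
      constructor
      · have : (p i).prob B / (p i).prob (A ⊔ B) ≤ 1 := by
          rw [div_le_one hpos, hadd]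
          linarith
        linarith
      · have : 1 - ε < (p i).prob B / (p i).prob (A ⊔ B) := by
          rw [lt_div_iff₀ hpos, hadd]
          rw [hadd] at hpos
          nlinarith
        linarith

theorem le_of_le {p : PPD F} {A B : F} (h : A ≤ B) : p.LE A B := by
  rw [le_iff, sdiff_eq_bot_iff.2 h]
  intro ε hε
  filter_upwards with i
  rw [(p i).prob_bot]
  exact mul_nonneg hε.le ((p i).nonneg B)

theorem LE.trans {p : PPD F} {A B C : F} (h1 : p.LE A B) (h2 : p.LE B C) : p.LE A C := by
  rw [le_iff] at h1 h2 ⊢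
  intro ε hε
  filter_upwards [h1 (ε / 4) (by positivity), h2 (min (ε / 2) 1) (by positivity)] with i hi1 hi2
  have hc := (p i).isContent
  have hsum : (p i).prob (A \ C) ≤ (p i).prob (A \ B) + (p i).prob (B \ C) := by
    rw [← hc.additive _ _
      (disjoint_coe_iff.2 (disjoint_sdiff_self_left.mono_right sdiff_le))]
    refine hc.mono ?_
    exact sdiff_triangle A B C
  have hB : (p i).prob B ≤ (p i).prob (B \ C) + (p i).prob C := by
    rw [← hc.additive _ _ (disjoint_coe_iff.2 disjoint_sdiff_self_left)]
    exact hc.mono le_sdiff_sup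
  have hC := hc.nonneg C
  have h3 : min (ε / 2) 1 * (p i).prob C ≤ ε / 2 * (p i).prob C :=
    mul_le_mul_of_nonneg_right (min_le_left _ _) hC
  have h4 : min (ε / 2) 1 * (p i).prob C ≤ 1 * (p i).prob C :=
    mul_le_mul_of_nonneg_right (min_le_right _ _) hC
  have h5 : (p i).prob B ≤ 2 * (p i).prob C := by linarith
  have h6 := mul_le_mul_of_nonneg_left h5 (by positivity : (0 : ℝ) ≤ ε / 4)
  linarith

theorem le_bot_iff {p : PPD F} {A : F} : p.LE A ⊥ ↔ ∀ᶠ i in atTop, (p i).prob A = 0 := by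
  rw [le_iff]
  constructor
  · intro h
    filter_upwards [h 1 one_pos] with i hi
    rw [sdiff_bot, (p i).prob_bot] at hi
    linarith [(p i).nonneg A]
  · intro h ε hε
    filter_upwards [h] with i hi
    rw [sdiff_bot, (p i).prob_bot, hi, mul_zero]

/-- Eventually each probability is at most half the other, so both vanish. -/
theorem sup_le_bot_of_le_of_le {p : PPD F} {A B : F} (hAB : Disjoint A B) (h1 : p.LE A B)
    (h2 : p.LE B A) : p.LE (A ⊔ B) ⊥ := by
  rw [le_iff] at h1 h2
  rw [le_bot_iff]
  filter_upwards [h1 (1 / 2) (by norm_num), h2 (1 / 2) (by norm_num)] with i hi1 hi2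
  rw [hAB.sdiff_eq_left] at hi1
  rw [hAB.sdiff_eq_right] at hi2
  rw [(p i).additive A B (disjoint_coe_iff.2 hAB)]
  linarith [(p i).nonneg A, (p i).nonneg B]

/-- The events, preordered by the likelihood comparison of a PPD. -/
@[reducible] def preorder (p : PPD F) : Preorder F where
  le := p.LE
  lt A B := p.LE A B ∧ ¬ p.LE B A
  le_refl _ := le_of_le le_rfl
  le_trans _ _ _ := LE.trans

/-- The values are the classes of the limit preorder; countability lets `Shrink` move them to any
universe. -/
theorem exists_arisesFrom [Countable F] (p : PPD F) :
    ∃ P : PlausibilityMeasure.{v, w} F, P.ArisesFrom p := by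
  let Q := @Antisymmetrization F p.LE (@instIsPreorderLe F p.preorder)
  let _ : PartialOrder Q := @instPartialOrderAntisymmetrization F p.preorder
  let q : F → Q := @toAntisymmetrization F p.LE (@instIsPreorderLe F p.preorder)
  have hq : ∀ A B, q A ≤ q B ↔ p.LE A B := fun A B => Iff.rfl
  have : Countable Q := Quotient.countable
  let s := equivShrink.{w} Q
  let _ : PartialOrder (Shrink.{w} Q) := PartialOrder.lift s.symm s.symm.injective
  have hs : ∀ a b : Q, s a ≤ s b ↔ a ≤ b := fun a b => by
    change s.symm (s a) ≤ s.symm (s b) ↔ _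
    simp
  let _ : BoundedOrder (Shrink.{w} Q) :=
    { top := s (q ⊤)
      le_top := fun a => by
        obtain ⟨a, rfl⟩ := s.surjective a
        induction a using Quotient.inductionOn with
        | h A => exact (hs _ _).2 ((hq A ⊤).2 (le_of_le le_top))
      bot := s (q ⊥)
      bot_le := fun a => by
        obtain ⟨a, rfl⟩ := s.surjective a
        induction a using Quotient.inductionOn with
        | h A => exact (hs _ _).2 ((hq ⊥ A).2 (le_of_le bot_le)) }
  exact ⟨{ D := Shrink.{w} Q
           Pl := fun A => s (q A)
           map_bot := rfl
           map_top := rfl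
           mono := fun A B h => (hs _ _).2 ((hq A B).2 (le_of_le h)) },
    fun A B => (hs _ _).trans (hq A B)⟩

end PPD

/-! ### Transfer of defaults and default-equivalence. -/

namespace PlausibilityMeasure

variable {L : BaseLanguage.{u}} {W : Type v} {π : Interpretation L W}

theorem disjoint_event_and_neg (φ ψ : L.Formula) :
    Disjoint (π.event (L.and φ (L.neg ψ))) (π.event (L.and φ ψ)) := by
  refine disjoint_coe_iff.1 (Set.disjoint_left.2 fun x h1 h2 => ?_)
  have h1' := ((π.isTruthAssignment x).and_iff _ _).1 h1
  exact ((π.isTruthAssignment x).neg_iff _).1 h1'.2 (((π.isTruthAssignment x).and_iff _ _).1 h2).2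

theorem event_and (φ ψ : L.Formula) : π.event (L.and φ ψ) = π.event φ ⊓ π.event ψ :=
  Subtype.ext (Set.ext fun x => (π.isTruthAssignment x).and_iff φ ψ)

theorem event_and_neg_sup (φ ψ : L.Formula) :
    π.event (L.and φ (L.neg ψ)) ⊔ π.event (L.and φ ψ) = π.event φ := by
  refine Subtype.ext (Set.ext fun x => ?_)
  have h1 := (π.isTruthAssignment x).and_iff φ (L.neg ψ)
  have h2 := (π.isTruthAssignment x).neg_iff ψ
  have h3 := (π.isTruthAssignment x).and_iff φ ψ
  change (π.truth x (L.and φ (L.neg ψ)) ∨ π.truth x (L.and φ ψ)) ↔ π.truth x φ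
  tauto

theorem DefaultEquivalent.pl_eq_bot_iff {F : BooleanSubalgebra (Set W)}
    {P P' : PlausibilityMeasure.{v, w} F} (h : P.DefaultEquivalent P') (A : F) :
    P.Pl A = ⊥ ↔ P'.Pl A = ⊥ := by
  have := h ⊥ A (disjoint_coe_iff.2 disjoint_bot_left)
  rw [P.map_bot, P'.map_bot, bot_lt_iff_ne_bot, bot_lt_iff_ne_bot] at this
  exact not_iff_not.1 this

theorem DefaultEquivalent.satDefault_iff {P P' : PlausibilityMeasure.{v, w} π.events}
    (h : P.DefaultEquivalent P') (φ ψ : L.Formula) : P.SatDefault φ ψ ↔ P'.SatDefault φ ψ :=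
  or_congr (h.pl_eq_bot_iff _) (h _ _ (disjoint_coe_iff.2 (disjoint_event_and_neg φ ψ)))

/-- The limit condition is the weak comparison of the two halves of `φ`. It is strict unless the
halves are equally plausible, and then, being disjoint, they are both null. -/
theorem ArisesFrom.satDefault_iff {P : PlausibilityMeasure.{v, w} π.events} {p : PPD π.events}
    (h : P.ArisesFrom p) (φ ψ : L.Formula) : P.SatDefault φ ψ ↔ p.SatDefault φ ψ := by
  have hdis := disjoint_event_and_neg (π := π) φ ψ
  have hsup := event_and_neg_sup (π := π) φ ψ
  have hp : p.SatDefault φ ψ ↔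
      P.Pl (π.event (L.and φ (L.neg ψ))) ≤ P.Pl (π.event (L.and φ ψ)) := by
    rw [h, hsup, PPD.SatDefault]
    refine Eq.to_iff (congrArg (fun f => Tendsto f atTop (𝓝 1)) (funext fun i => ?_))
    unfold ProbMeasure.cond
    rw [event_and, inf_right_comm, inf_idem, inf_comm]
  rw [hp]
  constructor
  · rintro (h0 | hlt)
    · have h1 : P.Pl (π.event (L.and φ (L.neg ψ))) ≤ P.Pl (π.event φ) :=
        P.monotone_pl (hsup ▸ le_sup_left)
      exact (h1.trans h0.le).trans bot_le
    · exact hlt.le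
  · intro hle
    refine or_iff_not_imp_right.2 fun hlt => ?_
    have hge := (eq_of_le_of_not_lt hle hlt).ge
    have h0 := (h _ _).2 (PPD.sup_le_bot_of_le_of_le hdis ((h _ _).1 hle) ((h _ _).1 hge))
    rw [hsup, P.map_bot] at h0
    exact le_bot_iff.1 h0

theorem ArisesFrom.defaultEquivalent {F : BooleanSubalgebra (Set W)}
    {P P' : PlausibilityMeasure.{v, w} F} {p : PPD F} (h : P'.ArisesFrom p)
    (hnull : ∀ A, P.Pl A = ⊥ → ∀ᶠ i in atTop, (p i).prob A = 0)
    (hlt : ∀ A B, Disjoint A B → P.Pl A < P.Pl B → ∀ ε > 0, ∀ᶠ i in atTop,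
      (p i).prob A ≤ ε * (p i).prob B ∧ 0 < (p i).prob B)
    (hnlt : ∀ A B, Disjoint A B → ¬ P.Pl A < P.Pl B → ∃ᶠ i in atTop,
      (p i).prob B ≤ (p i).prob A) : P.DefaultEquivalent P' := by
  intro A B hAB
  replace hAB := disjoint_coe_iff.1 hAB
  have hle : ∀ A B, P'.Pl A ≤ P'.Pl B ↔ p.LE A B := h
  constructor
  · intro hl
    have h1 : p.LE A B := by
      rw [PPD.le_iff, hAB.sdiff_eq_left]
      exact fun ε hε => (hlt A B hAB hl ε hε).mono fun i hi => hi.1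
    refine lt_of_le_not_ge ((hle _ _).2 h1) fun h2 => ?_
    have h3 := PPD.le_bot_iff.1 (PPD.sup_le_bot_of_le_of_le hAB h1 ((hle _ _).1 h2))
    obtain ⟨i, hi1, hi2⟩ := (h3.and (hlt A B hAB hl 1 one_pos)).exists
    have := (p i).isContent.mono (le_sup_right : B ≤ A ⊔ B)
    linarith [hi2.2]
  · intro hl
    by_contra hcon
    -- A null `B` cannot exceed anything. Otherwise `B` is eventually positive, and having at most
    -- half its probability in `A` contradicts the infinitely many refutations.
    by_cases hB : P.Pl B = ⊥
    · have h1 := (hle _ _).2 (PPD.le_bot_iff.2 (hnull B hB))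
      rw [P'.map_bot] at h1
      exact not_lt_bot (hl.trans_le h1)
    · have hpos := hlt ⊥ B disjoint_bot_left
        (by rw [P.map_bot]; exact bot_lt_iff_ne_bot.2 hB) 1 one_pos
      have h1 := PPD.le_iff.1 ((hle _ _).1 hl.le) (1 / 2) (by norm_num)
      rw [hAB.sdiff_eq_left] at h1
      obtain ⟨i, hi, hi1, hi2⟩ := ((hnlt A B hAB hcon).and_eventually (h1.and hpos)).exists
      linarith [hi2.2]

end PlausibilityMeasure

end Plausibility

theorem mainTheorem7 {L : Plausibility.BaseLanguage.{u}} (hL : Countable L.Formula)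
    {W : Type v} (π : Plausibility.Interpretation L W)
    (P : Plausibility.PlausibilityMeasure.{v, w} π.events)
    (hqual : P.IsQualitative) (hnormal : P.IsNormal) :
    ∃ (p : Plausibility.PPD π.events) (P' : Plausibility.PlausibilityMeasure.{v, w} π.events),
      P'.ArisesFrom p ∧ P.DefaultEquivalent P' ∧
      (∀ φ ψ : L.Formula, P.SatDefault φ ψ ↔ P'.SatDefault φ ψ) ∧
      (∀ φ ψ : L.Formula, P.SatDefault φ ψ ↔ p.SatDefault φ ψ) := by
  have : Countable π.events :=
    (Set.countable_range π.ext).to_subtype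
  obtain ⟨p, h1, h2, h3⟩ := hqual.exists_ppd hnormal
  obtain ⟨P', hP'⟩ := p.exists_arisesFrom
  have hequiv := hP'.defaultEquivalent h1 h2 h3
  exact ⟨p, P', hP', hequiv, hequiv.satDefault_iff,
    fun φ ψ => (hequiv.satDefault_iff φ ψ).trans (hP'.satDefault_iff φ ψ)⟩
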